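/- Let $\mathsf{Act}$ be a set of actions with an involutive complementation $a\mapsto\overline a$, and let $\tau,\checkmark\notin\mathsf{Act}$ be distinct. Let $\mathcal K$ be a set of constants, each constant $A\in\mathcal K$ having an associated definition $A\stackrel{\mathrm{def}}{=}p_A$. Terms of infinitary CCS are given by $$p ::= 1 \mid A \mid \mu.p \mid \textstyle\sum_{i\in I}p_i ,\qquad \mu\in\mathsf{Act}\cup\{\tau\},\ A\in\mathcal K,\ I \text{ countable}.$$ Recursive definitions can be made freely: for every countable system of definitions $X_n\stackrel{\mathrm{def}}{=}E_n$ $(n\in\mathbb N)$, with terms $E_n$ over the constants $X_0,X_1,\dots$, there are $A_0,A_1,\dots\in\mathcal K$ such that the definition of $A_n$ is $E_n$ with each $X_m$ replaced by $A_m$. Write $0$ for the empty sum and, for a countable set $S$ of terms, $\bigoplus S$ for $\sum_{p\in S}\tau.p$. Transitions $p\xrightarrow{\lambda}q$, $\lambda\in\mathsf{Act}\cup\{\tau,\checkmark\}$, are the least relations such that $1\xrightarrow{\checkmark}0$; $\mu.p\xrightarrow{\mu}p$; $\sum_{i\in I} p_i\xrightarrow{\lambda}p'$ if $p_j\xrightarrow{\lambda}p'$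 for some $j\in I$; and $A\xrightarrow{\lambda}p'$ if $p_A\xrightarrow{\lambda}p'$. Weak transitions $p\stackrel{s}{\Rightarrow}q$, $s\in\mathsf{Act}^*$, are finite transition sequences from $p$ to $q$ whose labels give $s$ when the $\tau$s are ignored; $p\stackrel{s}{\Rightarrow}$ means $p\stackrel{s}{\Rightarrow}q$ for some $q$. For $u=a_1a_2\cdots\in\mathsf{Act}^\infty$, $p\stackrel{u}{\Rightarrow}$ means that there are $p=p_0,p_1,p_2,\dots$ with $p_{i}\stackrel{a_{i+1}}{\Longrightarrow}p_{i+1}$ for all $i\ge 0$. Let $(p\ \mathrm{after}\ s)=\{q: p\stackrel{s}{\Rightarrow}q\}$. In a composition $p\,\|\,r$ of a server $p$ and a client $r$, either component may move alone, and $p\,\|\,r\xrightarrow{\tau}p'\,\|\,r'$ if $p\xrightarrow{a}p'$ and $r\xrightarrow{\overline a}r'$. A maximal computation is a sequence of $\tau$-transitions from $p\,\|\,r$ that is infinite or ends in a state without $\tau$-transitions. Write $p\ \mathrm{must}\ r$ if every maximal computation from $p\,\|\,r$ contains a state $p_k\,\|\,r_k$ with $r_k\xrightarrow{\checkmark}$.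 The server preorder $p\sqsubseteq_{\mathsf{svr}}q$ holds if $p\ \mathrm{must}\ r$ implies $q\ \mathrm{must}\ r$ for every term $r$. Write $p\Downarrow$ if there is no infinite sequence of $\tau$-transitions from $p$, and $p\in\mathcal U_{\mathsf{svr}}$ if $p\ \mathrm{must}\ r$ for some $r$. Define, by induction on finite traces: * $p\Downarrow\varepsilon$ iff $p\Downarrow$; and $p\Downarrow as$ iff $p\Downarrow$ and ($p\stackrel{a}{\Rightarrow}$ implies $\bigoplus(p\ \mathrm{after}\ a)\Downarrow s$); * $p\ \mathrm{usbl}\ \varepsilon$ iff $p\in\mathcal U_{\mathsf{svr}}$; and $p\ \mathrm{usbl}\ as$ iff $p\in\mathcal U_{\mathsf{svr}}$ and ($p\stackrel{a}{\Rightarrow}$ implies $\bigoplus(p\ \mathrm{after}\ a)\ \mathrm{usbl}\ s$). For infinite $u$, each of $p\Downarrow u$ and $p\ \mathrm{usbl}\ u$ means that the predicate holds along every finite prefix of $u$. For finite or infinite $w$, let $p\Downarrow_{\mathsf{svr}}w$ mean $p\Downarrow w$ and $p\ \mathrm{usbl}\ w$. For $s\in\mathsf{Act}^*$ let $\mathrm{ua}(p,s)=\{a\in\mathsf{Act}: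 p\stackrel{s}{\Rightarrow}\text{ implies }p\ \mathrm{usbl}\ sa\}$ and let $\mathrm{Acc}(p,s)=\{S(q): p\stackrel{s}{\Rightarrow}q,\ q\not\xrightarrow{\tau}\}$, where $S(q)=\{a\in\mathsf{Act}:q\xrightarrow{a}\}$. Let $p\preceq_{\mathsf{svr}}q$ mean: 1. for every $s\in\mathsf{Act}^*$ with $p\Downarrow_{\mathsf{svr}}s$: (a) $q\Downarrow_{\mathsf{svr}}s$, and (b) for every $B\in\mathrm{Acc}(q,s)$ there is $A\in\mathrm{Acc}(p,s)$ with $A\cap\mathrm{ua}(p,s)\subseteq B$; 2. for every $w\in\mathsf{Act}^*\cup\mathsf{Act}^\infty$ with $p\Downarrow_{\mathsf{svr}}w$: if $q\stackrel{w}{\Rightarrow}$ then $p\stackrel{w}{\Rightarrow}$. Theorem. For all terms $p,q$: $\;p\sqsubseteq_{\mathsf{svr}}q$ if and only if $p\preceq_{\mathsf{svr}}q$. -/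

import Mathlib

namespace CCS

/-- The set `Act ∪ {τ}`: visible actions together with the internal action. -/
inductive ActTau (Act : Type*) where
  | vis (a : Act)
  | tau

/-- The set `Act ∪ {τ, ✓}` of transition labels; `ok` is the success report `✓`. -/
inductive Label (Act : Type*) where
  | mu (μ : ActTau Act)
  | ok

/-- The label of a visible action. -/
abbrev Label.vis {Act : Type*} (a : Act) : Label Act := .mu (.vis a)

/-- The label `τ`. -/
abbrev Label.tau {Act : Type*} : Label Act := .mu .tau

/-- Terms of infinitary CCS over the actions `Act` and the definitional constants `K`:
the success constant `1`, constants, prefixes `μ.p`, and sums `∑_{i ∈ I} p_i` over a countable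
index set `I`, taken (up to renaming of indices) to be a set of natural numbers. -/
inductive Proc (Act : Type*) (K : Type*) where
  | one
  | const (A : K)
  | pre (μ : ActTau Act) (p : Proc Act K)
  | sum (I : Set ℕ) (p : I → Proc Act K)

variable {Act K : Type*}

/-- The terminated process `0`, i.e. the empty sum. -/
def Proc.nil : Proc Act K := .sum ∅ fun i => absurd i.2 (Set.notMem_empty _)

/-- Renaming of constants. -/
def Proc.rename {K' : Type*} (f : K → K') : Proc Act K → Proc Act K'
  | .one => .one
  | .const A => .const (f A)
  | .pre μ p => .pre μ (p.rename f)
  | .sum I p => .sum I fun i => (p i).rename f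

/-- The internal sum `⨁_{p ∈ S} p = ∑_{p ∈ S} τ.p` of a countable set `S` of processes; the
indices are obtained from an injection of `S` into the natural numbers. -/
noncomputable def Proc.intSum (S : Set (Proc Act K)) (hS : S.Countable) : Proc Act K :=
  let e : S → ℕ := Classical.choose hS.to_subtype.exists_injective_nat
  .sum (Set.range e) fun n => .pre .tau (Set.rangeSplitting e n : S).1

/-- A system of definitions `A ≝ D A`, one for every constant. -/
abbrev Defns (Act : Type*) (K : Type*) := K → Proc Act K

/-- Recursive definitions may be made freely: every countable system of simultaneous definitions
`X_n ≝ E n` (`n ∈ ℕ`), where the `E n` are terms over the constants `X_0, X_1, …`, occurs among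
the definitions `D`, for suitable constants `f 0, f 1, …` in the place of the `X_n`. -/
def Defns.Expressive (D : Defns Act K) : Prop :=
  ∀ E : ℕ → Proc Act ℕ, ∃ f : ℕ → K, ∀ n, D (f n) = (E n).rename f

/-- The labelled transition system of CCS: `Step D p l q` is `p —l→ q`. -/
inductive Step (D : Defns Act K) : Proc Act K → Label Act → Proc Act K → Prop
  | ok : Step D .one .ok .nil
  | pre (μ : ActTau Act) (p : Proc Act K) : Step D (.pre μ p) (.mu μ) p
  | sum {I : Set ℕ} {p : I → Proc Act K} {l : Label Act} {p' : Proc Act K} (i : I) :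
      Step D (p i) l p' → Step D (.sum I p) l p'
  | const {A : K} {l : Label Act} {p' : Proc Act K} :
      Step D (D A) l p' → Step D (.const A) l p'

/-- `p —l→`. -/
def Can (D : Defns Act K) (p : Proc Act K) (l : Label Act) : Prop := ∃ q, Step D p l q

/-- Weak transitions `p ⟹[s] q` along finite traces `s ∈ Act*`. -/
inductive Weak (D : Defns Act K) : Proc Act K → List Act → Proc Act K → Prop
  | refl (p : Proc Act K) : Weak D p [] p
  | tau {p p' q : Proc Act K} {s : List Act} :
      Step D p .tau p' → Weak D p' s q → Weak D p s q
  | vis {p p' q : Proc Act K} {a : Act} {s : List Act} :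
      Step D p (.vis a) p' → Weak D p' s q → Weak D p (a :: s) q

/-- `p ⟹[s]` for a finite trace `s`. -/
def CanWeak (D : Defns Act K) (p : Proc Act K) (s : List Act) : Prop := ∃ q, Weak D p s q

/-- `p ⟹[u]` for an infinite trace `u`. -/
def CanWeakInf (D : Defns Act K) (p : Proc Act K) (u : ℕ → Act) : Prop :=
  ∃ f : ℕ → Proc Act K, f 0 = p ∧ ∀ n, Weak D (f n) [u n] (f (n + 1))

/-- The prefix of length `n` of an infinite trace. -/
def tracePrefix (u : ℕ → Act) (n : ℕ) : List Act := (List.range n).map u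

/-- The set `p after s`. -/
def after (D : Defns Act K) (p : Proc Act K) (s : List Act) : Set (Proc Act K) :=
  {q | Weak D p s q}

section Countability

/-- The derivatives of a process that have a derivation of height at most `n`. -/
def derivs (D : Defns Act K) : ℕ → Proc Act K → Set (Proc Act K)
  | 0, _ => ∅
  | _ + 1, .one => {.nil}
  | n + 1, .const A => derivs D n (D A)
  | _ + 1, .pre _ p => {p}
  | n + 1, .sum _ p => ⋃ i, derivs D n (p i)

theorem countable_derivs (D : Defns Act K) (n : ℕ) (p : Proc Act K) :
    (derivs D n p).Countable := by
  induction n generalizing p with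
  | zero => simp [derivs]
  | succ n ih =>
    cases p with
    | one => simp [derivs]
    | const A => simpa [derivs] using ih _
    | pre μ p => simp [derivs]
    | sum I p => simpa [derivs] using fun a ha => ih (p ⟨a, ha⟩)

theorem Step.exists_mem_derivs {D : Defns Act K} {p q : Proc Act K} {l : Label Act}
    (h : Step D p l q) : ∃ n, q ∈ derivs D n p := by
  induction h with
  | ok => exact ⟨1, by simp [derivs]⟩
  | pre μ p => exact ⟨1, by simp [derivs]⟩
  | sum i _ ih =>
    obtain ⟨n, hn⟩ := ih
    exact ⟨n + 1, Set.mem_iUnion.2 ⟨i, hn⟩⟩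
  | const _ ih =>
    obtain ⟨n, hn⟩ := ih
    exact ⟨n + 1, hn⟩

/-- The processes reachable from `p` in exactly `n` steps. -/
def reach (D : Defns Act K) (p : Proc Act K) : ℕ → Set (Proc Act K)
  | 0 => {p}
  | n + 1 => ⋃ q ∈ reach D p n, ⋃ m, derivs D m q

theorem countable_reach (D : Defns Act K) (p : Proc Act K) (n : ℕ) :
    (reach D p n).Countable := by
  induction n with
  | zero => simp [reach]
  | succ n ih =>
    exact ih.biUnion fun q _ => Set.countable_iUnion fun m => countable_derivs D m q

theorem Weak.mem_reach {D : Defns Act K} {p q r : Proc Act K} {s : List Act}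
    (h : Weak D q s r) : ∀ n, q ∈ reach D p n → ∃ m, r ∈ reach D p m := by
  induction h with
  | refl q => exact fun n hn => ⟨n, hn⟩
  | tau hs _ ih =>
    intro n hn
    obtain ⟨m, hm⟩ := hs.exists_mem_derivs
    exact ih (n + 1) (Set.mem_biUnion hn (Set.mem_iUnion.2 ⟨m, hm⟩))
  | vis hs _ ih =>
    intro n hn
    obtain ⟨m, hm⟩ := hs.exists_mem_derivs
    exact ih (n + 1) (Set.mem_biUnion hn (Set.mem_iUnion.2 ⟨m, hm⟩))

/-- `p after s` is countable, so that its internal sum is a CCS term. -/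
theorem countable_after (D : Defns Act K) (p : Proc Act K) (s : List Act) :
    (after D p s).Countable := by
  refine (Set.countable_iUnion fun n => countable_reach D p n).mono fun q hq => ?_
  exact Set.mem_iUnion.2 (Weak.mem_reach hq 0 (by simp [reach]))

end Countability

/-- The process `⨁ (p after a)`. -/
noncomputable def residual (D : Defns Act K) (p : Proc Act K) (a : Act) : Proc Act K :=
  .intSum (after D p [a]) (countable_after D p [a])

section Testing

/-- Transitions of the composition `p ‖ r` of a server and a client; `co` is complementation. -/
inductive ParStep (co : Act → Act) (D : Defns Act K) :
    Proc Act K × Proc Act K → Label Act → Proc Act K × Proc Act K → Prop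
  | left {p p' r : Proc Act K} {l : Label Act} :
      Step D p l p' → ParStep co D (p, r) l (p', r)
  | right {p r r' : Proc Act K} {l : Label Act} :
      Step D r l r' → ParStep co D (p, r) l (p, r')
  | synch {p p' r r' : Proc Act K} {a : Act} :
      Step D p (.vis a) p' → Step D r (.vis (co a)) r' → ParStep co D (p, r) .tau (p', r')

/-- `c 0 —τ→ c 1 —τ→ ⋯` is a maximal computation from `p ‖ r` with `N ≤ ∞` steps. Only the values
`c k` with `k ≤ N` are part of the computation. -/
structure IsMaximalComputation (co : Act → Act) (D : Defns Act K) (p r : Proc Act K)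
    (N : ℕ∞) (c : ℕ → Proc Act K × Proc Act K) : Prop where
  start : c 0 = (p, r)
  step : ∀ k : ℕ, (k : ℕ∞) < N → ParStep co D (c k) .tau (c (k + 1))
  maximal : ∀ n : ℕ, N = n → ¬ ∃ c', ParStep co D (c n) .tau c'

/-- `p must r`: every maximal computation from `p ‖ r` is client-successful. -/
def Must (co : Act → Act) (D : Defns Act K) (p r : Proc Act K) : Prop :=
  ∀ (N : ℕ∞) (c : ℕ → Proc Act K × Proc Act K), IsMaximalComputation co D p r N c →
    ∃ k : ℕ, (k : ℕ∞) ≤ N ∧ Can D (c k).2 .ok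

/-- The server preorder `p ⊑_svr q`. -/
def ServerPreorder (co : Act → Act) (D : Defns Act K) (p q : Proc Act K) : Prop :=
  ∀ r : Proc Act K, Must co D p r → Must co D q r

end Testing

section Semantic

/-- `p ⇓`: there is no infinite sequence of `τ`-transitions from `p`. -/
def Converges (D : Defns Act K) (p : Proc Act K) : Prop :=
  ¬ ∃ f : ℕ → Proc Act K, f 0 = p ∧ ∀ n, Step D (f n) .tau (f (n + 1))

/-- Convergence `p ⇓ s` along a finite trace. -/
def ConvergesAlong (D : Defns Act K) : Proc Act K → List Act → Prop
  | p, [] => Converges D p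
  | p, a :: s => Converges D p ∧ (CanWeak D p [a] → ConvergesAlong D (residual D p a) s)

/-- The set `U_svr` of usable servers. -/
def usableServers (co : Act → Act) (D : Defns Act K) : Set (Proc Act K) :=
  {p | ∃ r, Must co D p r}

/-- Server usability `p usbl s` along a finite trace. -/
def UsableAlong (co : Act → Act) (D : Defns Act K) : Proc Act K → List Act → Prop
  | p, [] => p ∈ usableServers co D
  | p, a :: s => p ∈ usableServers co D ∧
      (CanWeak D p [a] → UsableAlong co D (residual D p a) s)

/-- The server convergence predicate along a finite trace: convergence and usability. -/
def ServerConvergesAlong (co : Act → Act) (D : Defns Act K) (p : Proc Act K)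
    (s : List Act) : Prop :=
  ConvergesAlong D p s ∧ UsableAlong co D p s

/-- The server convergence predicate along an infinite trace, i.e. along all its finite
prefixes. -/
def ServerConvergesAlongInf (co : Act → Act) (D : Defns Act K) (p : Proc Act K)
    (u : ℕ → Act) : Prop :=
  (∀ n, ConvergesAlong D p (tracePrefix u n)) ∧ ∀ n, UsableAlong co D p (tracePrefix u n)

/-- The actions that are usable for the server `p` after the trace `s`. -/
def usableActions (co : Act → Act) (D : Defns Act K) (p : Proc Act K) (s : List Act) : Set Act :=
  {a | CanWeak D p s → UsableAlong co D p (s ++ [a])}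

/-- The ready set `S(q)`. -/
def readySet (D : Defns Act K) (q : Proc Act K) : Set Act := {a | Can D q (.vis a)}

/-- The acceptance set of `p` after `s`. -/
def acceptances (D : Defns Act K) (p : Proc Act K) (s : List Act) : Set (Set Act) :=
  {B | ∃ q, Weak D p s q ∧ ¬ Can D q .tau ∧ B = readySet D q}

/-- The semantic server preorder `p ≼_svr q`. -/
structure SemanticServerPreorder (co : Act → Act) (D : Defns Act K) (p q : Proc Act K) : Prop where
  converges : ∀ s, ServerConvergesAlong co D p s → ServerConvergesAlong co D q s
  accepts : ∀ s, ServerConvergesAlong co D p s → ∀ B ∈ acceptances D q s,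
    ∃ A ∈ acceptances D p s, A ∩ usableActions co D p s ⊆ B
  traces : ∀ s : List Act, ServerConvergesAlong co D p s → CanWeak D q s → CanWeak D p s
  infTraces : ∀ u : ℕ → Act, ServerConvergesAlongInf co D p u →
    CanWeakInf D q u → CanWeakInf D p u

end Semantic

end CCS

/-! The client `1` succeeds in its initial state, so every server satisfies `1` and is usable.
Usability along traces therefore always holds, every action is usable, and the claim becomes the
classical characterization of the must preorder by convergence, acceptance sets and infinite traces.

Failure of `Must` is the greatest invariant of compositions with unsuccessful clients that are stuck
or have a successor in the invariant. Hence a failing run can be built or taken apart one step at a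
time.

Soundness (`SemanticServerPreorder.serverPreorder`): a failing run of `q ‖ r` splits at its
communications. If it has finitely many, it ends in a divergence of the server, a divergence of the
client, or a stuck state; if it has infinitely many, it spells an infinite trace. Each case is
excluded or turned into a failing run of `p ‖ r` by one of the clauses.

Completeness (`ServerPreorder.semanticServerPreorder`): each clause is tested by clients that follow
a trace and may escape to success by `τ` before each communication. Against convergent servers such
a client can fail only by completing its trace, so its tail decides the outcome. -/

namespace CCS

variable {Act K : Type*} {co : Act → Act} {D : Defns Act K}

/-! ### Composition and splitting of weak transitions -/

section Transitions

theorem Weak.trans {p q r : Proc Act K} {s t : List Act} (h : Weak D p s q) (h' : Weak D q t r) :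
    Weak D p (s ++ t) r := by
  induction h with
  | refl => exact h'
  | tau hs _ ih => exact .tau hs (ih h')
  | vis hs _ ih => exact .vis hs (ih h')

theorem Weak.exists_of_cons {p q : Proc Act K} {a : Act} {s : List Act}
    (h : Weak D p (a :: s) q) :
    ∃ p₁ p₂, Weak D p [] p₁ ∧ Step D p₁ (.vis a) p₂ ∧ Weak D p₂ s q := by
  generalize hw : a :: s = w at h
  induction h with
  | refl => cases hw
  | tau hs _ ih =>
    obtain ⟨p₁, p₂, h₁, h₂, h₃⟩ := ih hw
    exact ⟨p₁, p₂, .tau hs h₁, h₂, h₃⟩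
  | vis hs hq =>
    cases hw
    exact ⟨_, _, .refl _, hs, hq⟩

theorem Weak.exists_of_append {p q : Proc Act K} {s t : List Act} (h : Weak D p (s ++ t) q) :
    ∃ p', Weak D p s p' ∧ Weak D p' t q := by
  generalize hw : s ++ t = w at h
  induction h generalizing s with
  | refl p =>
    obtain ⟨rfl, rfl⟩ := List.append_eq_nil_iff.1 hw
    exact ⟨p, .refl _, .refl _⟩
  | tau hs _ ih =>
    obtain ⟨p', h₁, h₂⟩ := ih hw
    exact ⟨p', .tau hs h₁, h₂⟩
  | @vis p p₁ q a w hs hq ih =>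
    cases s with
    | nil =>
      obtain rfl : t = a :: w := hw
      exact ⟨p, .refl _, .vis hs hq⟩
    | cons b s =>
      obtain ⟨rfl, hw'⟩ := List.cons.inj hw
      obtain ⟨p', h₁, h₂⟩ := ih hw'
      exact ⟨p', .vis hs h₁, h₂⟩

/-- Weak transitions all of whose states, including the first and the last one, do not report
success. -/
inductive UnsuccWeak (D : Defns Act K) : Proc Act K → List Act → Proc Act K → Prop
  | refl {r : Proc Act K} : ¬ Can D r .ok → UnsuccWeak D r [] r
  | tau {r r' t : Proc Act K} {s : List Act} : ¬ Can D r .ok →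
      Step D r .tau r' → UnsuccWeak D r' s t → UnsuccWeak D r s t
  | vis {r r' t : Proc Act K} {a : Act} {s : List Act} : ¬ Can D r .ok →
      Step D r (.vis a) r' → UnsuccWeak D r' s t → UnsuccWeak D r (a :: s) t

theorem UnsuccWeak.not_ok {r t : Proc Act K} {s : List Act} (h : UnsuccWeak D r s t) :
    ¬ Can D r .ok := by
  cases h <;> assumption

theorem UnsuccWeak.not_ok_last {r t : Proc Act K} {s : List Act} (h : UnsuccWeak D r s t) :
    ¬ Can D t .ok := by
  induction h <;> assumption

theorem UnsuccWeak.trans {p q r : Proc Act K} {s t : List Act} (h : UnsuccWeak D p s q)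
    (h' : UnsuccWeak D q t r) : UnsuccWeak D p (s ++ t) r := by
  induction h with
  | refl => exact h'
  | tau ho hs _ ih => exact .tau ho hs (ih h')
  | vis ho hs _ ih => exact .vis ho hs (ih h')

theorem UnsuccWeak.exists_of_append {p q : Proc Act K} {s t : List Act}
    (h : UnsuccWeak D p (s ++ t) q) : ∃ p', UnsuccWeak D p s p' := by
  generalize hw : s ++ t = w at h
  induction h generalizing s with
  | refl ho =>
    obtain ⟨rfl, rfl⟩ := List.append_eq_nil_iff.1 hw
    exact ⟨_, .refl ho⟩
  | tau ho hs _ ih =>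
    obtain ⟨p', h₁⟩ := ih hw
    exact ⟨p', .tau ho hs h₁⟩
  | vis ho hs hq ih =>
    cases s with
    | nil => exact ⟨_, .refl ho⟩
    | cons b s =>
      obtain ⟨rfl, hw'⟩ := List.cons.inj hw
      obtain ⟨p', h₁⟩ := ih hw'
      exact ⟨p', .vis ho hs h₁⟩

end Transitions

/-! ### Convergence as well-foundedness -/

section Convergence

theorem converges_iff_acc {p : Proc Act K} :
    Converges D p ↔ Acc (fun y x => Step D x .tau y) p := by
  rw [← not_iff_not, not_acc_iff_exists_descending_chain]
  simp [Converges]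

theorem Converges.of_step {p q : Proc Act K} (h : Converges D p) (hs : Step D p .tau q) :
    Converges D q := by
  rw [converges_iff_acc] at h ⊢
  exact h.inv hs

theorem Converges.of_weak {p q : Proc Act K} (h : Converges D p) (hw : Weak D p [] q) :
    Converges D q := by
  generalize hs : ([] : List Act) = s at hw
  induction hw with
  | refl => exact h
  | tau h' _ ih => exact ih (h.of_step h') hs
  | vis => cases hs

theorem Converges.exists_stable {p : Proc Act K} (h : Converges D p) :
    ∃ q, Weak D p [] q ∧ ¬ Can D q .tau := by
  rw [converges_iff_acc] at h
  induction h with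
  | intro p _ ih =>
    by_cases hp : Can D p .tau
    · obtain ⟨p', hp'⟩ := hp
      obtain ⟨q, hq, hst⟩ := ih p' hp'
      exact ⟨q, .tau hp' hq, hst⟩
    · exact ⟨p, .refl _, hp⟩

theorem step_intSum {S : Set (Proc Act K)} {hS : S.Countable} {l : Label Act} {q : Proc Act K} :
    Step D (.intSum S hS) l q ↔ l = .tau ∧ q ∈ S := by
  have hinj := Classical.choose_spec hS.to_subtype.exists_injective_nat
  unfold Proc.intSum
  constructor
  · intro h
    cases h with
    | sum i h =>
      cases h
      exact ⟨rfl, Subtype.property _⟩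
  · rintro ⟨rfl, hq⟩
    refine .sum ⟨_, ⟨q, hq⟩, rfl⟩ ?_
    have := Set.apply_rangeSplitting (Classical.choose hS.to_subtype.exists_injective_nat)
      ⟨_, ⟨q, hq⟩, rfl⟩
    rw [hinj this]
    exact .pre _ _

theorem weak_residual {p q : Proc Act K} {a : Act} {s : List Act}
    (h : Weak D (residual D p a) s q) : s = [] ∧ q = residual D p a ∨ Weak D p (a :: s) q := by
  cases h with
  | refl => exact .inl ⟨rfl, rfl⟩
  | tau hs hw =>
    right
    obtain ⟨-, h⟩ := step_intSum.1 hs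
    exact h.trans hw
  | vis hs => cases (step_intSum.1 hs).1

theorem Weak.residual {p q : Proc Act K} {a : Act} {s : List Act} (h : Weak D p (a :: s) q) :
    Weak D (residual D p a) s q := by
  obtain ⟨p', h₁, h₂⟩ := Weak.exists_of_append (s := [a]) h
  exact .tau (step_intSum.2 ⟨rfl, h₁⟩) h₂

/-- The residual has only `τ`-steps, exactly to the members of `after D p [a]`. So it converges iff
they all do, and its other derivatives are derivatives of `p`. -/
theorem convergesAlong_iff {p : Proc Act K} {s : List Act} :
    ConvergesAlong D p s ↔ ∀ s' q, s' <+: s → Weak D p s' q → Converges D q := by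
  induction s generalizing p with
  | nil =>
    simp only [ConvergesAlong, List.prefix_nil]
    constructor
    · rintro h s' q rfl hq
      exact h.of_weak hq
    · exact fun h => h _ _ rfl (.refl _)
  | cons a s ih =>
    simp only [ConvergesAlong, ih]
    constructor
    · rintro ⟨hp, h⟩ s' q hs' hq
      cases s' with
      | nil => exact hp.of_weak hq
      | cons b t =>
        obtain ⟨rfl, ht⟩ := List.cons_prefix_cons.1 hs'
        obtain ⟨p', hp', -⟩ := Weak.exists_of_append (s := [b]) hq
        exact h ⟨p', hp'⟩ t q ht hq.residual
    · refine fun h => ⟨h _ _ List.nil_prefix (.refl _), fun _ s' q hs' hq => ?_⟩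
      have key : ∀ q, Weak D p (a :: s') q → Converges D q := fun q =>
        h _ q (List.cons_prefix_cons.2 ⟨rfl, hs'⟩)
      obtain ⟨rfl, rfl⟩ | hq := weak_residual hq
      · rw [converges_iff_acc]
        refine ⟨_, fun q hq => ?_⟩
        rw [← converges_iff_acc]
        exact key _ (step_intSum.1 hq).2
      · exact key _ hq

end Convergence

/-! ### Failing computations as invariants -/

section Failure

/-- The composition `x` has no `τ`-transitions. -/
def Stuck (co : Act → Act) (D : Defns Act K) (x : Proc Act K × Proc Act K) : Prop :=
  ¬ ∃ y, ParStep co D x .tau y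

/-- A set of compositions from which the client can be kept from ever reporting success. -/
def FailInvariant (co : Act → Act) (D : Defns Act K) (R : Proc Act K × Proc Act K → Prop) :
    Prop :=
  ∀ x, R x → ¬ Can D x.2 .ok ∧ (Stuck co D x ∨ ∃ y, ParStep co D x .tau y ∧ R y)

/-- Iterating a chosen successor inside `R` gives an unsuccessful computation, cut off at the first
stuck state if there is one. -/
theorem FailInvariant.not_must {R : Proc Act K × Proc Act K → Prop} (hR : FailInvariant co D R)
    {p r : Proc Act K} (h : R (p, r)) : ¬ Must co D p r := by
  classical
  choose g hg using fun x : {x // R x ∧ ¬ Stuck co D x} =>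
    ((hR x.1 x.2.1).2.resolve_left x.2.2)
  let next : Proc Act K × Proc Act K → Proc Act K × Proc Act K := fun x =>
    if hx : R x ∧ ¬ Stuck co D x then g ⟨x, hx⟩ else x
  let c : ℕ → Proc Act K × Proc Act K := fun n => next^[n] (p, r)
  have hnext : ∀ x, R x → R (next x) := by
    intro x hx
    by_cases hst : Stuck co D x
    · simpa [next, hst] using hx
    · simpa [next, hx, hst] using (hg ⟨x, hx, hst⟩).2
  have hc : ∀ n, c (n + 1) = next (c n) := fun n => Function.iterate_succ_apply' _ _ _
  have hRc : ∀ n, R (c n) := by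
    intro n
    induction n with
    | zero => exact h
    | succ n ih => rw [hc]; exact hnext _ ih
  have hstep : ∀ n, ¬ Stuck co D (c n) → ParStep co D (c n) .tau (c (n + 1)) := by
    intro n hn
    rw [hc]
    simpa [next, hRc n, hn] using (hg ⟨c n, hRc n, hn⟩).1
  intro hm
  by_cases hst : ∃ n, Stuck co D (c n)
  · obtain ⟨k, -, hk⟩ := hm (Nat.find hst : ℕ) c ⟨rfl, fun k hk => hstep k
      (Nat.find_min hst (by exact_mod_cast hk)), fun n hn => by
        have : Nat.find hst = n := by exact_mod_cast hn
        exact this ▸ Nat.find_spec hst⟩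
    exact (hR _ (hRc k)).1 hk
  · obtain ⟨k, -, hk⟩ := hm ⊤ c ⟨rfl, fun k _ => hstep k fun h => hst ⟨k, h⟩,
      fun n hn => absurd hn (ENat.top_ne_natCast n)⟩
    exact (hR _ (hRc k)).1 hk

/-- The states visited by a failing computation form an invariant, so each of them fails as well.
With `FailInvariant.not_must` this makes failure the greatest invariant. -/
theorem failInvariant_not_must :
    FailInvariant co D fun x => ¬ Must co D x.1 x.2 := by
  rintro ⟨p, r⟩ h
  simp only [Must, not_forall] at h
  obtain ⟨N, c, hc, hok⟩ := h
  have hinv : FailInvariant co D fun x => ∃ k : ℕ, (k : ℕ∞) ≤ N ∧ x = c k := by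
    rintro _ ⟨k, hk, rfl⟩
    refine ⟨fun h => hok ⟨k, hk, h⟩, ?_⟩
    obtain hk | rfl := hk.lt_or_eq
    · exact .inr ⟨_, hc.step k hk, k + 1, by exact_mod_cast Order.add_one_le_of_lt hk, rfl⟩
    · exact .inl (hc.maximal k rfl)
  obtain ⟨h₁, h₂⟩ := hinv (p, r) ⟨0, zero_le, hc.start.symm⟩
  refine ⟨h₁, h₂.imp_right ?_⟩
  rintro ⟨y, hy, hRy⟩
  exact ⟨y, hy, hinv.not_must hRy⟩

theorem not_ok_of_not_must {p r : Proc Act K} (h : ¬ Must co D p r) : ¬ Can D r .ok :=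
  (failInvariant_not_must (p, r) h).1

theorem not_must_of_stuck {p r : Proc Act K} (hr : ¬ Can D r .ok) (h : Stuck co D (p, r)) :
    ¬ Must co D p r := by
  refine FailInvariant.not_must (R := fun x => x = (p, r)) ?_ rfl
  rintro _ rfl
  exact ⟨hr, .inl h⟩

theorem not_must_of_step {p r p' r' : Proc Act K} (hr : ¬ Can D r .ok)
    (h : ParStep co D (p, r) .tau (p', r')) (h' : ¬ Must co D p' r') : ¬ Must co D p r := by
  refine FailInvariant.not_must (R := fun x => x = (p, r) ∨ ¬ Must co D x.1 x.2) ?_ (.inl rfl)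
  rintro x (rfl | hx)
  · exact ⟨hr, .inr ⟨_, h, .inr h'⟩⟩
  · obtain ⟨h₁, h₂⟩ := failInvariant_not_must x hx
    exact ⟨h₁, h₂.imp_right fun ⟨y, hy, hy'⟩ => ⟨y, hy, .inr hy'⟩⟩

theorem not_must_of_not_converges {p r : Proc Act K} (hr : ¬ Can D r .ok)
    (h : ¬ Converges D p) : ¬ Must co D p r := by
  refine FailInvariant.not_must (R := fun x => ¬ Converges D x.1 ∧ x.2 = r) ?_ ⟨h, rfl⟩
  rintro ⟨p, r⟩ ⟨hp, rfl⟩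
  refine ⟨hr, .inr ?_⟩
  simp only [converges_iff_acc] at hp ⊢
  by_contra! hno
  exact hp ⟨_, fun y hy => not_not.1 fun hy' => hno (y, r) (.left hy) hy' rfl⟩

/-- Inaccessibility means an infinite `τ`-run of the client through unsuccessful states; the server
idles meanwhile. -/
theorem not_must_of_client_diverges {p r : Proc Act K}
    (h : ¬ Acc (fun y x => ¬ Can D x .ok ∧ Step D x .tau y) r) : ¬ Must co D p r := by
  refine FailInvariant.not_must
    (R := fun x => ¬ Acc (fun y x => ¬ Can D x .ok ∧ Step D x .tau y) x.2) ?_ h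
  rintro ⟨p, r⟩ h
  have : ∃ y, (¬ Can D r .ok ∧ Step D r .tau y) ∧
      ¬ Acc (fun y x => ¬ Can D x .ok ∧ Step D x .tau y) y := by
    by_contra! hno
    exact h ⟨_, hno⟩
  obtain ⟨y, ⟨hr, hy⟩, hy'⟩ := this
  exact ⟨hr, .inr ⟨(p, y), .right hy, hy'⟩⟩

theorem not_must_of_weak_nil {p p' r : Proc Act K} (hw : Weak D p [] p')
    (h : ¬ Must co D p' r) : ¬ Must co D p r := by
  generalize hs : ([] : List Act) = s at hw
  induction hw with
  | refl => exact h
  | tau h' _ ih => exact not_must_of_step (not_ok_of_not_must h) (.left h') (ih h hs)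
  | vis => cases hs

theorem not_must_of_weak {p p' r r' : Proc Act K} {s : List Act} (hp : Weak D p s p')
    (hr : UnsuccWeak D r (s.map co) r') (h : ¬ Must co D p' r') : ¬ Must co D p r := by
  generalize hs : s.map co = w at hr
  induction hr generalizing p s with
  | refl =>
    obtain rfl := List.map_eq_nil_iff.1 hs
    exact not_must_of_weak_nil hp h
  | tau ho h' _ ih => exact not_must_of_step ho (.right h') (ih hp h hs)
  | vis ho h' _ ih =>
    obtain ⟨a, t, rfl, rfl, ht⟩ := List.map_eq_cons_iff.1 hs
    obtain ⟨p₁, p₂, h₁, h₂, h₃⟩ := hp.exists_of_cons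
    exact not_must_of_weak_nil h₁ (not_must_of_step ho (.synch h₂ h') (ih h₃ h ht))

theorem not_must_of_infinite {u : ℕ → Act} {f g : ℕ → Proc Act K}
    (hf : ∀ n, Weak D (f n) [u n] (f (n + 1)))
    (hg : ∀ n, UnsuccWeak D (g n) [co (u n)] (g (n + 1))) : ¬ Must co D (f 0) (g 0) := by
  -- The invariant remembers what both components still have to do in the current block `n`.
  refine FailInvariant.not_must (R := fun x => ∃ n, Weak D x.1 [u n] (f (n + 1)) ∧
    UnsuccWeak D x.2 [co (u n)] (g (n + 1))) ?_ ⟨0, hf 0, hg 0⟩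
  rintro ⟨p, r⟩ ⟨n, hp, hr⟩
  refine ⟨hr.not_ok, .inr ?_⟩
  cases hr with
  | tau _ hs hr => exact ⟨(p, _), .right hs, n, hp, hr⟩
  | vis _ hs hr =>
    cases hp with
    | tau hs' hp => exact ⟨(_, r), .left hs', n, hp, .vis ‹_› hs hr⟩
    -- The silent remainders of block `n` are prepended to block `n + 1`.
    | vis hs' hp => exact ⟨(_, _), .synch hs' hs, n + 1, hp.trans (hf _), hr.trans (hg _)⟩

/-- A failing composition of a convergent server and a client without unsuccessful divergence
either reaches a stuck state without communicating or communicates. -/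
theorem exists_communication {q r : Proc Act K} (hq : Converges D q)
    (hr : Acc (fun y x => ¬ Can D x .ok ∧ Step D x .tau y) r) (h : ¬ Must co D q r) :
    (∃ q' r', Weak D q [] q' ∧ UnsuccWeak D r [] r' ∧ Stuck co D (q', r')) ∨
    ∃ a q' r', Weak D q [a] q' ∧ UnsuccWeak D r [co a] r' ∧ ¬ Must co D q' r' := by
  -- Lexicographic induction: a server step may be followed by any accessible client, a client step
  -- leaves the server unchanged.
  rw [converges_iff_acc] at hq
  induction hq generalizing r with
  | intro q hq ihq =>
    induction hr with
    | intro r hr ihr =>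
      obtain ⟨ho, hst | ⟨⟨q', r'⟩, hs, hf⟩⟩ := failInvariant_not_must (_, _) h
      · exact .inl ⟨q, r, .refl _, .refl ho, hst⟩
      · cases hs with
        | left hs =>
          obtain ⟨q₁, r₁, h₁, h₂, h₃⟩ | ⟨a, q₁, r₁, h₁, h₂, h₃⟩ := ihq q' hs ⟨_, hr⟩ hf
          · exact .inl ⟨q₁, r₁, .tau hs h₁, h₂, h₃⟩
          · exact .inr ⟨a, q₁, r₁, .tau hs h₁, h₂, h₃⟩
        | right hs =>
          obtain ⟨q₁, r₁, h₁, h₂, h₃⟩ | ⟨a, q₁, r₁, h₁, h₂, h₃⟩ := ihr r' ⟨ho, hs⟩ hf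
          · exact .inl ⟨q₁, r₁, h₁, .tau ho hs h₂, h₃⟩
          · exact .inr ⟨a, q₁, r₁, h₁, .tau ho hs h₂, h₃⟩
        | @synch _ _ _ _ a hs hs' =>
          exact .inr ⟨a, q', r', .vis hs (.refl _),
            .vis ho hs' (.refl (not_ok_of_not_must hf)), hf⟩

end Failure

/-! ### Triviality of the usability conditions -/

section Usability

theorem must_one (p : Proc Act K) : Must co D p .one := by
  intro N c hc
  refine ⟨0, zero_le, ?_⟩
  rw [hc.start]
  exact ⟨_, .ok⟩

theorem usableAlong (p : Proc Act K) (s : List Act) : UsableAlong co D p s := by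
  induction s generalizing p with
  | nil => exact ⟨_, must_one p⟩
  | cons a s ih => exact ⟨⟨_, must_one p⟩, fun _ => ih _⟩

theorem serverConvergesAlong_iff {p : Proc Act K} {s : List Act} :
    ServerConvergesAlong co D p s ↔ ConvergesAlong D p s :=
  and_iff_left (usableAlong p s)

theorem usableActions_eq_univ (p : Proc Act K) (s : List Act) :
    usableActions co D p s = Set.univ :=
  Set.eq_univ_of_forall fun _ _ => usableAlong _ _

end Usability

theorem tracePrefix_succ (u : ℕ → Act) (n : ℕ) :
    tracePrefix u (n + 1) = tracePrefix u n ++ [u n] := by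
  simp [tracePrefix, List.range_succ]

/-! ### Soundness: transferring failing runs from `q` to `p` -/

section Soundness

/-- A divergence of `p` reached along a prefix of `s` could be run beside the still unsuccessful
client. -/
theorem ConvergesAlong.of_must {p r r' : Proc Act K} {s : List Act} (hm : Must co D p r)
    (hr : UnsuccWeak D r (s.map co) r') : ConvergesAlong D p s := by
  rw [convergesAlong_iff]
  rintro s' p' ⟨t, rfl⟩ hp'
  by_contra hdiv
  rw [List.map_append] at hr
  obtain ⟨r₁, hr₁⟩ := hr.exists_of_append
  exact not_must_of_weak hp' hr₁ (not_must_of_not_converges hr₁.not_ok_last hdiv) hm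

theorem SemanticServerPreorder.serverPreorder {p q : Proc Act K}
    (h : SemanticServerPreorder co D p q) : ServerPreorder co D p q := by
  intro r hm
  by_contra hf
  have hconv : ∀ s r', UnsuccWeak D r (s.map co) r' → ServerConvergesAlong co D p s :=
    fun s r' hr => serverConvergesAlong_iff.2 (.of_must hm hr)
  -- Failing states of `q ‖ r`, together with the trace of communications leading to them.
  let State := {x : List Act × Proc Act K × Proc Act K // Weak D q x.1 x.2.1 ∧
    UnsuccWeak D r (x.1.map co) x.2.2 ∧ ¬ Must co D x.2.1 x.2.2}
  have hnext : ∀ x : State, ∃ (a : Act) (y : State), y.1.1 = x.1.1 ++ [a] ∧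
      Weak D x.1.2.1 [a] y.1.2.1 ∧ UnsuccWeak D x.1.2.2 [co a] y.1.2.2 := by
    rintro ⟨⟨s, q', r'⟩, hq, hr, hf⟩
    have hs := hconv s r' hr
    have hq' : Converges D q' := convergesAlong_iff.1 (h.converges s hs).1 s q'
      List.prefix_rfl hq
    have hr' : Acc (fun y x => ¬ Can D x .ok ∧ Step D x .tau y) r' := by
      by_contra hdiv
      obtain ⟨p', hp'⟩ := h.traces s hs ⟨q', hq⟩
      exact not_must_of_weak hp' hr (not_must_of_client_diverges hdiv) hm
    obtain ⟨q₁, r₁, h₁, h₂, hst⟩ | ⟨a, q₁, r₁, h₁, h₂, h₃⟩ := exists_communication hq' hr' hf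
    · exfalso
      have hq₁ : Weak D q s q₁ := by simpa using hq.trans h₁
      have hr₁ : UnsuccWeak D r (s.map co) r₁ := by simpa using hr.trans h₂
      -- A stuck state yields a stable `p'` offering no more than `q₁`, so `p'` is stuck with `r₁`
      -- too.
      obtain ⟨_, ⟨p', hp', hp'st, rfl⟩, hA⟩ := h.accepts s hs _
        ⟨q₁, hq₁, fun ⟨y, hy⟩ => hst ⟨(y, r₁), .left hy⟩, rfl⟩
      rw [usableActions_eq_univ, Set.inter_univ] at hA
      refine not_must_of_weak hp' hr₁ (not_must_of_stuck hr₁.not_ok_last ?_) hm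
      rintro ⟨⟨p₂, r₂⟩, hs₂⟩
      cases hs₂ with
      | left hs₂ => exact hp'st ⟨_, hs₂⟩
      | right hs₂ => exact hst ⟨(q₁, _), .right hs₂⟩
      | synch hs₂ hs₃ =>
        obtain ⟨q₂, hq₂⟩ := hA ⟨_, hs₂⟩
        exact hst ⟨_, .synch hq₂ hs₃⟩
    · exact ⟨a, ⟨(s ++ [a], q₁, r₁), hq.trans h₁, by simpa using hr.trans h₂, h₃⟩, rfl, h₁, h₂⟩
  choose a next hn₁ hn₂ hn₃ using hnext
  let c : ℕ → State := fun n =>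
    next^[n] ⟨([], q, r), .refl _, .refl (not_ok_of_not_must hf), hf⟩
  have hc : ∀ n, c (n + 1) = next (c n) := fun n => Function.iterate_succ_apply' _ _ _
  let u : ℕ → Act := fun n => a (c n)
  have htr : ∀ n, (c n).1.1 = tracePrefix u n := by
    intro n
    induction n with
    | zero => rfl
    | succ n ih => rw [hc, hn₁, ih, tracePrefix_succ]
  have hu : ∀ n, ServerConvergesAlong co D p (tracePrefix u n) := fun n =>
    hconv _ (c n).1.2.2 (htr n ▸ (c n).2.2.1)
  -- Communication never ends, so `q` performs `u`; hence so does `p`, against the same client run.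
  obtain ⟨f, rfl, hf⟩ := h.infTraces u ⟨fun n => (hu n).1, fun n => (hu n).2⟩
    ⟨fun n => (c n).1.2.1, rfl, fun n => by simpa only [hc] using hn₂ (c n)⟩
  exact not_must_of_infinite (g := fun n => (c n).1.2.2) hf
    (fun n => by simpa only [hc] using hn₃ (c n)) hm

end Soundness

/-! ### Completeness: the distinguishing clients -/

section Completeness

/-- The binary sum `p + q`. -/
def Proc.choice (p q : Proc Act K) : Proc Act K :=
  .sum Set.univ fun i => if (i : ℕ) = 0 then p else q

theorem step_choice {p q p' : Proc Act K} {l : Label Act} :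
    Step D (.choice p q) l p' ↔ Step D p l p' ∨ Step D q l p' := by
  constructor
  · intro h
    cases h with
    | sum i h =>
      dsimp only at h
      split_ifs at h
      · exact .inl h
      · exact .inr h
  · rintro (h | h)
    · exact .sum ⟨0, trivial⟩ (by simpa using h)
    · exact .sum ⟨1, trivial⟩ (by simpa using h)

theorem step_pre {μ : ActTau Act} {p p' : Proc Act K} {l : Label Act} :
    Step D (.pre μ p) l p' ↔ l = .mu μ ∧ p' = p := by
  constructor
  · intro h
    cases h
    exact ⟨rfl, rfl⟩
  · rintro ⟨rfl, rfl⟩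
    exact .pre _ _

/-- The transitions of `τ.1 + a.t`: the client that may succeed at once or offer `a`. -/
def Offers (D : Defns Act K) (r : Proc Act K) (a : Act) (t : Proc Act K) : Prop :=
  ∀ l r', Step D r l r' ↔ l = .tau ∧ r' = .one ∨ l = .vis a ∧ r' = t

theorem offers_choice (a : Act) (t : Proc Act K) :
    Offers D (.choice (.pre .tau .one) (.pre (.vis a) t)) a t := by
  intro l r'
  rw [step_choice, step_pre, step_pre]

theorem Offers.not_ok {r t : Proc Act K} {a : Act} (h : Offers D r a t) : ¬ Can D r .ok := by
  rintro ⟨r', hr'⟩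
  simpa using (h _ _).1 hr'

theorem Offers.step_vis {r t : Proc Act K} {a : Act} (h : Offers D r a t) :
    Step D r (.vis a) t :=
  (h _ _).2 (.inr ⟨rfl, rfl⟩)

theorem Offers.unsuccWeak {r t : Proc Act K} {a : Act} (h : Offers D r a t)
    (ht : ¬ Can D t .ok) : UnsuccWeak D r [a] t :=
  .vis h.not_ok h.step_vis (.refl ht)

/-- The server cannot move alone forever, the composition is never stuck because of the `τ`-branch,
and that branch succeeds. So a failing run must communicate on `a`. -/
theorem Offers.exists_weak (hco : Function.Involutive co) {p r t : Proc Act K} {a : Act}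
    (h : Offers D r (co a) t) (hp : Converges D p) (hf : ¬ Must co D p r) :
    ∃ p', Weak D p [a] p' ∧ ¬ Must co D p' t := by
  rw [converges_iff_acc] at hp
  induction hp with
  | intro p _ ih =>
    obtain ⟨-, hst | ⟨⟨p', r'⟩, hs, hf'⟩⟩ := failInvariant_not_must (_, _) hf
    · exact absurd ⟨(p, .one), .right ((h _ _).2 (.inl ⟨rfl, rfl⟩))⟩ hst
    · cases hs with
      | left hs =>
        obtain ⟨p₁, h₁, h₂⟩ := ih p' hs hf'
        exact ⟨p₁, .tau hs h₁, h₂⟩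
      | right hs =>
        obtain ⟨-, rfl⟩ | ⟨hl, -⟩ := (h _ _).1 hs
        · exact absurd (must_one _) hf'
        · cases hl
      | @synch _ _ _ _ b hs hs' =>
        obtain ⟨hl, -⟩ | ⟨hl, rfl⟩ := (h _ _).1 hs'
        · cases hl
        · obtain rfl : b = a := hco.injective (by simpa using hl)
          exact ⟨p', .vis hs (.refl _), hf'⟩

/-- The client that offers the complement of `s`, may succeed at any point before that is
completed, and then continues as `t`. -/
def along (co : Act → Act) (t : Proc Act K) : List Act → Proc Act K
  | [] => t
  | a :: s => .choice (.pre .tau .one) (.pre (.vis (co a)) (along co t s))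

theorem not_ok_along {t : Proc Act K} (ht : ¬ Can D t .ok) (s : List Act) :
    ¬ Can D (along co t s) .ok := by
  cases s with
  | nil => exact ht
  | cons a s => exact (offers_choice _ _).not_ok

theorem unsuccWeak_along {t : Proc Act K} (ht : ¬ Can D t .ok) (s s' : List Act) :
    UnsuccWeak D (along co t (s ++ s')) (s.map co) (along co t s') := by
  induction s with
  | nil => exact .refl (not_ok_along ht _)
  | cons a s ih =>
    exact ((offers_choice _ _).unsuccWeak (not_ok_along ht _)).trans ih

theorem must_along (hco : Function.Involutive co) {p t : Proc Act K} {s : List Act}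
    (hp : ConvergesAlong D p s) (ht : ∀ p', Weak D p s p' → Must co D p' t) :
    Must co D p (along co t s) := by
  rw [convergesAlong_iff] at hp
  induction s generalizing p with
  | nil => exact ht _ (.refl _)
  | cons a s ih =>
    by_contra hf
    obtain ⟨p', hp', hf'⟩ := (offers_choice (co a) (along co t s)).exists_weak hco
      (hp [] p List.nil_prefix (.refl _)) hf
    refine hf' (ih (fun s' q hs' hq => ?_) fun p'' h => ht _ (hp'.trans h))
    exact hp _ q (List.cons_prefix_cons.2 ⟨rfl, hs'⟩) (hp'.trans hq)

theorem not_must_along {p p' t : Proc Act K} {s : List Act} (hp : Weak D p s p')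
    (h : ¬ Must co D p' t) : ¬ Must co D p (along co t s) := by
  have := unsuccWeak_along (co := co) (not_ok_of_not_must h) s []
  rw [List.append_nil] at this
  exact not_must_of_weak hp this h

theorem must_tau_one {p : Proc Act K} (hp : Converges D p) :
    Must co D p (.pre .tau .one) := by
  rw [converges_iff_acc] at hp
  induction hp with
  | intro p _ ih =>
    by_contra hf
    obtain ⟨-, hst | ⟨⟨p', r'⟩, hs, hf'⟩⟩ := failInvariant_not_must (_, _) hf
    · exact hst ⟨(p, .one), .right (.pre _ _)⟩
    · cases hs with
      | left hs => exact hf' (ih p' hs)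
      | right hs =>
        obtain ⟨-, rfl⟩ := step_pre.1 hs
        exact hf' (must_one _)
      | synch _ hs => cases (step_pre.1 hs).1

theorem must_along_tau_one_iff (hco : Function.Involutive co) {p : Proc Act K} {s : List Act} :
    Must co D p (along co (.pre .tau .one) s) ↔ ConvergesAlong D p s := by
  constructor
  · intro hm
    have := unsuccWeak_along (D := D) (co := co) (t := .pre .tau .one)
      (fun ⟨r', hr'⟩ => by simpa using (step_pre.1 hr').1) s []
    exact .of_must hm (by rwa [List.append_nil] at this)
  · exact fun hp => must_along hco hp fun p' hp' =>
      must_tau_one (convergesAlong_iff.1 hp s p' List.prefix_rfl hp')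

/-- The visible actions of a process that have a derivation of height at most `n`. -/
def enabled (D : Defns Act K) : ℕ → Proc Act K → Set Act
  | 0, _ => ∅
  | _ + 1, .one => ∅
  | n + 1, .const A => enabled D n (D A)
  | _ + 1, .pre (.vis a) _ => {a}
  | _ + 1, .pre .tau _ => ∅
  | n + 1, .sum _ p => ⋃ i, enabled D n (p i)

theorem countable_enabled (D : Defns Act K) (n : ℕ) (p : Proc Act K) :
    (enabled D n p).Countable := by
  induction n generalizing p with
  | zero => simp [enabled]
  | succ n ih =>
    rcases p with _ | A | ⟨_ | _, p⟩ | ⟨I, p⟩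
    · simp [enabled]
    · exact ih _
    · simp [enabled]
    · simp [enabled]
    · exact Set.countable_iUnion fun i => ih _

theorem Step.exists_mem_enabled {p q : Proc Act K} {a : Act} (h : Step D p (.vis a) q) :
    ∃ n, a ∈ enabled D n p := by
  generalize hl : Label.vis a = l at h
  induction h with
  | ok => cases hl
  | pre μ p =>
    cases hl
    exact ⟨1, rfl⟩
  | sum i _ ih =>
    obtain ⟨n, hn⟩ := ih hl
    exact ⟨n + 1, Set.mem_iUnion.2 ⟨i, hn⟩⟩
  | const _ ih =>
    obtain ⟨n, hn⟩ := ih hl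
    exact ⟨n + 1, hn⟩

/-- `Act` may be uncountable; this bound lets a countable sum offer everything needed in the
acceptance test. -/
theorem countable_readySet (D : Defns Act K) (q : Proc Act K) : (readySet D q).Countable :=
  (Set.countable_iUnion fun n => countable_enabled D n q).mono fun _ ⟨_, h⟩ =>
    Set.mem_iUnion.2 h.exists_mem_enabled

theorem exists_offer_all {L : Set Act} (hL : L.Countable) :
    ∃ r : Proc Act K, ∀ l r', Step D r l r' ↔ ∃ a ∈ L, l = .vis a ∧ r' = .one := by
  have := hL.to_subtype
  obtain ⟨e, he⟩ := exists_injective_nat L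
  refine ⟨.sum (Set.range e) fun n => .pre (.vis (Set.rangeSplitting e n).1) .one,
    fun l r' => ⟨fun h => ?_, ?_⟩⟩
  · cases h with
    | sum i h => exact ⟨_, Subtype.property _, step_pre.1 h⟩
  · rintro ⟨a, ha, rfl, rfl⟩
    refine .sum ⟨_, ⟨a, ha⟩, rfl⟩ ?_
    rw [he (Set.apply_rangeSplitting e ⟨_, ⟨a, ha⟩, rfl⟩)]
    exact .pre _ _

theorem must_offer {L : Set Act} {p r : Proc Act K}
    (hr : ∀ l r', Step D r l r' ↔ ∃ a ∈ co '' L, l = .vis a ∧ r' = .one)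
    (hp : Converges D p)
    (h : ∀ q, Weak D p [] q → ¬ Can D q .tau → (readySet D q ∩ L).Nonempty) :
    Must co D p r := by
  rw [converges_iff_acc] at hp
  induction hp with
  | intro p _ ih =>
    by_contra hf
    obtain ⟨-, hst | ⟨⟨p', r'⟩, hs, hf'⟩⟩ := failInvariant_not_must (_, _) hf
    · obtain ⟨a, ⟨p', hp'⟩, ha⟩ := h p (.refl _) fun ⟨p', hp'⟩ => hst ⟨(p', r), .left hp'⟩
      exact hst ⟨(p', .one), .synch hp' ((hr _ _).2 ⟨_, ⟨a, ha, rfl⟩, rfl, rfl⟩)⟩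
    · cases hs with
      | left hs => exact hf' (ih p' hs fun q hq => h q (.tau hs hq))
      | right hs =>
        obtain ⟨a, -, hl, -⟩ := (hr _ _).1 hs
        cases hl
      | synch _ hs =>
        obtain ⟨a, -, -, rfl⟩ := (hr _ _).1 hs
        exact hf' (must_one _)

theorem ServerPreorder.accepts (hco : Function.Involutive co) {p q : Proc Act K}
    (h : ServerPreorder co D p q) {s : List Act} (hs : ConvergesAlong D p s) {B : Set Act}
    (hB : B ∈ acceptances D q s) : ∃ A ∈ acceptances D p s, A ⊆ B := by
  by_contra! hno
  obtain ⟨q', hq', hst, rfl⟩ := hB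
  -- After `s`, the client offers the co-actions of what some derivative of `p` can do but `q'`
  -- cannot. If no acceptance of `p` lies in that of `q'`, each stable derivative of `p` can
  -- communicate, while `q'` is stuck.
  have hL : (⋃ p' ∈ after D p s, readySet D p').Countable :=
    (countable_after D p s).biUnion fun p' _ => countable_readySet D p'
  obtain ⟨r, hr⟩ := exists_offer_all (D := D)
    ((hL.mono (Set.sdiff_subset (t := readySet D q'))).image co)
  refine not_must_along (t := r) hq' (not_must_of_stuck ?_ ?_) (h _ (must_along hco hs ?_))
  · rintro ⟨r', hr'⟩
    obtain ⟨a, -, hl, -⟩ := (hr _ _).1 hr'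
    cases hl
  · rintro ⟨⟨q₁, r₁⟩, hs⟩
    cases hs with
    | left hs => exact hst ⟨_, hs⟩
    | right hs =>
      obtain ⟨a, -, hl, -⟩ := (hr _ _).1 hs
      cases hl
    | @synch _ _ _ _ b hs hs' =>
      obtain ⟨_, ⟨a, ha, rfl⟩, hl, -⟩ := (hr _ _).1 hs'
      obtain rfl : b = a := hco.injective (by simpa using hl)
      exact ha.2 ⟨_, hs⟩
  · intro p' hp'
    refine must_offer hr (convergesAlong_iff.1 hs s p' List.prefix_rfl hp') fun p₁ hp₁ hst₁ => ?_
    have hp₁' : Weak D p s p₁ := by simpa using hp'.trans hp₁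
    obtain ⟨a, ha, ha'⟩ := Set.not_subset.1 (hno _ ⟨p₁, hp₁', hst₁, rfl⟩)
    exact ⟨a, ha, Set.mem_biUnion (show p₁ ∈ after D p s from hp₁') ha, ha'⟩

theorem Defns.Expressive.exists_infinite_offer (hD : D.Expressive) (v : ℕ → Act) :
    ∃ g : ℕ → Proc Act K, ∀ n, Offers D (g n) (v n) (g (n + 1)) := by
  obtain ⟨f, hf⟩ := hD fun n => .choice (.pre .tau .one) (.pre (.vis (v n)) (.const (n + 1)))
  refine ⟨fun n => .const (f n), fun n l r' => ?_⟩
  have hfn : D (f n) = .choice (.pre .tau .one) (.pre (.vis (v n)) (.const (f (n + 1)))) := by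
    rw [hf, Proc.choice, Proc.rename, Proc.choice]
    congr 1
    funext i
    split_ifs <;> rfl
  rw [← offers_choice (v n) (.const (f (n + 1))) l r', ← hfn]
  exact ⟨fun h => by cases h; assumption, .const⟩

/-- Branching may be infinite, so finite prefixes alone do not give the infinite trace. Carrying
along the failure of the current derivative against the rest of the client ensures that it can be
extended. -/
theorem ServerPreorder.infTraces (hco : Function.Involutive co) (hD : D.Expressive)
    {p q : Proc Act K} (h : ServerPreorder co D p q) {u : ℕ → Act}
    (hu : ∀ n, ConvergesAlong D p (tracePrefix u n)) (hq : CanWeakInf D q u) :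
    CanWeakInf D p u := by
  obtain ⟨g, hg⟩ := hD.exists_infinite_offer fun n => co (u n)
  have hqf : ¬ Must co D q (g 0) := by
    obtain ⟨f, rfl, hf⟩ := hq
    exact not_must_of_infinite hf fun n => (hg n).unsuccWeak (hg (n + 1)).not_ok
  have hpf : ¬ Must co D p (g 0) := fun hm => hqf (h _ hm)
  have hnext : ∀ n (x : {x // Weak D p (tracePrefix u n) x ∧ ¬ Must co D x (g n)}),
      ∃ y : {y // Weak D p (tracePrefix u (n + 1)) y ∧ ¬ Must co D y (g (n + 1))},
        Weak D x.1 [u n] y.1 := by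
    rintro n ⟨x, hx, hxf⟩
    obtain ⟨y, hy, hyf⟩ := (hg n).exists_weak hco
      (convergesAlong_iff.1 (hu n) _ x List.prefix_rfl hx) hxf
    exact ⟨⟨y, tracePrefix_succ u n ▸ hx.trans hy, hyf⟩, hy⟩
  choose next hn using hnext
  exact ⟨fun n => (Nat.rec (motive := fun n =>
    {x // Weak D p (tracePrefix u n) x ∧ ¬ Must co D x (g n)}) ⟨p, .refl _, hpf⟩ next n).1,
    rfl, fun n => hn n _⟩

theorem ServerPreorder.semanticServerPreorder (hco : Function.Involutive co)
    (hD : D.Expressive) {p q : Proc Act K} (h : ServerPreorder co D p q) :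
    SemanticServerPreorder co D p q := by
  have hconv : ∀ s, ConvergesAlong D p s → ConvergesAlong D q s := fun s hs =>
    (must_along_tau_one_iff hco).1 (h _ ((must_along_tau_one_iff hco).2 hs))
  refine ⟨fun s hs => ⟨hconv s hs.1, usableAlong q s⟩, fun s hs B hB => ?_,
    fun s hs hq => ?_, fun u hu => h.infTraces hco hD hu.1⟩
  · rw [usableActions_eq_univ]
    simpa using h.accepts hco hs.1 hB
  · obtain ⟨q', hq'⟩ := hq
    -- Finite traces follow from acceptances: convergence gives `q` a stable derivative after `s`,
    -- and the matching acceptance of `p` is witnessed by a derivative after `s`.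
    obtain ⟨q₁, hq₁, hst⟩ := (convergesAlong_iff.1 (hconv s hs.1) s q' List.prefix_rfl
      hq').exists_stable
    obtain ⟨_, ⟨p', hp', -⟩, -⟩ := h.accepts hco hs.1
      ⟨q₁, by simpa using hq'.trans hq₁, hst, rfl⟩
    exact ⟨p', hp'⟩

end Completeness

end CCS

theorem mainTheorem3 {Act K : Type*} (co : Act → Act) (hco : Function.Involutive co)
    (D : CCS.Defns Act K) (hD : D.Expressive) (p q : CCS.Proc Act K) :
    CCS.ServerPreorder co D p q ↔ CCS.SemanticServerPreorder co D p q :=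
  ⟨fun h => h.semanticServerPreorder hco hD, fun h => h.serverPreorder⟩
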